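/- Let $X$ be a compact complex manifold of dimension $n$ and let $\mathcal B=\{s^{(1)},\dots,s^{(n)}\}\subset H^0(X,T_X)$ be global holomorphic vector fields which generate $T_X$ at the general point, i.e. at every point of a dense open subset of $X$ (so $X$ is almost homogeneous). Let $V=\langle s^{(1)},\dots,s^{(n)}\rangle_{\mathbb C}$ be their linear span. Then: 1. There is an effective divisor $D_V$ in the anticanonical system $|-K_X|$ (the set of zero divisors of global holomorphic sections of $-K_X=\bigwedge^nT_X$ that vanish identically on no nonempty open set) which is the zero divisor of the section $s^{(1)}\wedge\dots\wedge s^{(n)}$. It depends only on $V$: it is also the zero divisor of $t^{(1)}\wedge\dots\wedge t^{(n)}$ whenever $t^{(1)},\dots,t^{(n)}\in H^0(X,T_X)$ span $V$. The support of $D_V$ is the set of points where $s^{(1)}\wedge\dots\wedge s^{(n)}$ vanishes, and its complement $X\setminus D_V$ is the set of points $x$ where the $s^{(i)}(x)$ generate $T_{X,x}$. 2. For $x\in X\setminus D_V$ let $s_{(1)},\dots,s_{(n)}\in T_{X,x}^*$ be the basis dual to $s^{(1)}(x),\dots,s^{(n)}(x)$, and put $$g_{\mathcal B}(u\otimes \bar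 v)=\sum_{i=1}^n s_{(i)}(u)\,\overline{s_{(i)}(v)}\qquad(u,v\in T_{X,x}).$$ Then $g_{\mathcal B}$ is a smooth hermitian metric on $X\setminus D_V$, and it is Ricci-flat: its Ricci form, given in holomorphic coordinates by $\frac{i}{2\pi}\partial\bar\partial\log\det\big(g_{\mathcal B}(\tfrac{\partial}{\partial z^j}\otimes\tfrac{\partial}{\partial\bar z^k})\big)_{j,k}$, vanishes on $X\setminus D_V$. 3. The metric $g_{\mathcal B}$ is Kähler on $X\setminus D_V$ (i.e. its fundamental form is closed) if and only if $V$ is abelian, i.e. $[\zeta,\xi]=0$ for all $\zeta,\xi\in V$. -/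

import Mathlib

open scoped Manifold ContDiff

noncomputable section

namespace FrameGeometry

/-- The space `H⁰(T_X)` of global holomorphic vector fields on an `n`-dimensional complex manifold,
i.e. complex-analytic sections of the holomorphic tangent bundle. -/
abbrev HolVectorField (n : ℕ) (X : Type*) [TopologicalSpace X] [ChartedSpace (Fin n → ℂ) X]
    [IsManifold 𝓘(ℂ, Fin n → ℂ) ω X] : Type _ :=
  ContMDiffSection 𝓘(ℂ, Fin n → ℂ) (Fin n → ℂ) ω
    (fun x : X => TangentSpace 𝓘(ℂ, Fin n → ℂ) x)

/-- The holomorphic charts of `X`. -/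
abbrev holCharts (n : ℕ) (X : Type*) [TopologicalSpace X] [ChartedSpace (Fin n → ℂ) X] :
    Set (OpenPartialHomeomorph X (Fin n → ℂ)) :=
  IsManifold.maximalAtlas 𝓘(ℂ, Fin n → ℂ) ω X

/-! ### Holomorphic functions and effective divisors -/

/-- `f` is holomorphic (complex analytic) on the (open) set `U`. -/
def HolomorphicOn (n : ℕ) {X : Type*} [TopologicalSpace X] [ChartedSpace (Fin n → ℂ) X]
    (f : X → ℂ) (U : Set X) : Prop :=
  ContMDiffOn 𝓘(ℂ, Fin n → ℂ) 𝓘(ℂ, ℂ) ω f U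

/-- On the set `A`, the function `g` is locally the product of `f` with a holomorphic function
without zeros. -/
def LocallyAssociatedOn (n : ℕ) {X : Type*} [TopologicalSpace X] [ChartedSpace (Fin n → ℂ) X]
    (f g : X → ℂ) (A : Set X) : Prop :=
  ∀ x ∈ A, ∃ W : Set X, IsOpen W ∧ x ∈ W ∧ ∃ u : X → ℂ, HolomorphicOn n u W ∧
    (∀ y ∈ W, u y ≠ 0) ∧ ∀ y ∈ W ∩ A, g y = u y * f y

/-- An effective (Cartier) divisor on a complex manifold, given as the maximal system of its local
equations: holomorphic functions on open sets, not identically zero on any nonempty open subset,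
whose domains cover `X` and which differ by holomorphic units on overlaps. -/
@[ext]
structure EffectiveDivisor (n : ℕ) (X : Type*) [TopologicalSpace X]
    [ChartedSpace (Fin n → ℂ) X] where
  /-- `f` is an equation of the divisor on the open set `U` -/
  IsLocalEq : TopologicalSpace.Opens X → (X → ℂ) → Prop
  holomorphicOn : ∀ U f, IsLocalEq U f → HolomorphicOn n f U
  nontrivial : ∀ U f, IsLocalEq U f →
    ∀ W : Set X, IsOpen W → W.Nonempty → W ⊆ U → ∃ x ∈ W, f x ≠ 0
  cover : ∀ x : X, ∃ U f, x ∈ U ∧ IsLocalEq U f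
  compatible : ∀ U f V g, IsLocalEq U f → IsLocalEq V g →
    LocallyAssociatedOn n f g ((U : Set X) ∩ V)
  maximal : ∀ (U : TopologicalSpace.Opens X) (f : X → ℂ),
    (∀ V g, IsLocalEq V g → LocallyAssociatedOn n g f ((U : Set X) ∩ V)) → IsLocalEq U f

/-- The support of an effective divisor: the common zero set of its local equations. -/
def EffectiveDivisor.support {n : ℕ} {X : Type*} [TopologicalSpace X]
    [ChartedSpace (Fin n → ℂ) X] (D : EffectiveDivisor n X) : Set X :=
  {x | ∃ U f, x ∈ U ∧ D.IsLocalEq U f ∧ f x = 0}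

/-! ### The anticanonical bundle `-K_X = ⋀ⁿ T_X` -/

/-- Set-theoretic sections of `⋀ⁿ T_X`. -/
abbrev MultivectorField (n : ℕ) (X : Type*) [TopologicalSpace X]
    [ChartedSpace (Fin n → ℂ) X] : Type _ :=
  (x : X) → ⋀[ℂ]^n (TangentSpace 𝓘(ℂ, Fin n → ℂ) x)

/-- The holomorphic volume form `dz¹ ∧ … ∧ dzⁿ` of the chart `e` at the point `x`. -/
def chartVolume {n : ℕ} {X : Type*} [TopologicalSpace X] [ChartedSpace (Fin n → ℂ) X]
    (e : OpenPartialHomeomorph X (Fin n → ℂ)) (x : X) :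
    TangentSpace 𝓘(ℂ, Fin n → ℂ) x [⋀^Fin n]→ₗ[ℂ] ℂ :=
  let dz : TangentSpace 𝓘(ℂ, Fin n → ℂ) x →L[ℂ] (Fin n → ℂ) :=
    mfderiv 𝓘(ℂ, Fin n → ℂ) 𝓘(ℂ, Fin n → ℂ) e x
  (Pi.basisFun ℂ (Fin n)).det.compLinearMap dz.toLinearMap

/-- The coefficient `c` in `t = c • ∂₁ ∧ … ∧ ∂ₙ` with respect to the chart `e`, obtained by pairing
`t` with `dz¹ ∧ … ∧ dzⁿ`. -/
def MultivectorField.coeff {n : ℕ} {X : Type*} [TopologicalSpace X] [ChartedSpace (Fin n → ℂ) X]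
    (t : MultivectorField n X) (e : OpenPartialHomeomorph X (Fin n → ℂ)) (x : X) : ℂ :=
  exteriorPower.alternatingMapLinearEquiv (chartVolume e x) (t x)

/-- `t` is a holomorphic section of the anticanonical bundle. -/
def MultivectorField.IsHolomorphic {n : ℕ} {X : Type*} [TopologicalSpace X]
    [ChartedSpace (Fin n → ℂ) X] (t : MultivectorField n X) : Prop :=
  ∀ e ∈ holCharts n X, HolomorphicOn n (t.coeff e) e.source

/-- `D` is the zero divisor of the section `t`: the coefficients of `t` in the holomorphic charts
are local equations of `D`. (This determines `D`.) -/
def EffectiveDivisor.IsZeroDivisorOf {n : ℕ} {X : Type*} [TopologicalSpace X]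
    [ChartedSpace (Fin n → ℂ) X] (D : EffectiveDivisor n X) (t : MultivectorField n X) : Prop :=
  ∀ e ∈ holCharts n X, D.IsLocalEq ⟨e.source, e.open_source⟩ (t.coeff e)

/-- The anticanonical linear system `|-K_X|`: zero divisors of global holomorphic sections of
`-K_X`. -/
def anticanonicalSystem (n : ℕ) (X : Type*) [TopologicalSpace X] [ChartedSpace (Fin n → ℂ) X] :
    Set (EffectiveDivisor n X) :=
  {D | ∃ t : MultivectorField n X, t.IsHolomorphic ∧ D.IsZeroDivisorOf t}

/-! ### Hermitian metrics on open subsets -/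

/-- A family of functions `T_x × T_x → ℂ`; hermitian metrics are such families. The value at
`(u, v)` stands for `g(u ⊗ v̄)`. -/
abbrev PairingField (n : ℕ) (X : Type*) [TopologicalSpace X]
    [ChartedSpace (Fin n → ℂ) X] : Type _ :=
  (x : X) → TangentSpace 𝓘(ℂ, Fin n → ℂ) x → TangentSpace 𝓘(ℂ, Fin n → ℂ) x → ℂ

/-- The coordinate vector field `∂/∂zʲ` of the chart `e`, at the point with coordinates `z`. -/
def coordVector {n : ℕ} {X : Type*} [TopologicalSpace X] [ChartedSpace (Fin n → ℂ) X]
    (e : OpenPartialHomeomorph X (Fin n → ℂ)) (z : Fin n → ℂ) (j : Fin n) :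
    TangentSpace 𝓘(ℂ, Fin n → ℂ) (e.symm z) :=
  mfderiv 𝓘(ℂ, Fin n → ℂ) 𝓘(ℂ, Fin n → ℂ) e.symm z (Pi.single j 1 : Fin n → ℂ)

/-- The matrix `g_{jk} = g(∂/∂zʲ ⊗ ∂/∂z̄ᵏ)` of `g` in the chart `e`, as a function of the
coordinates. -/
def PairingField.matrix {n : ℕ} {X : Type*} [TopologicalSpace X] [ChartedSpace (Fin n → ℂ) X]
    (g : PairingField n X) (e : OpenPartialHomeomorph X (Fin n → ℂ)) (z : Fin n → ℂ) :
    Matrix (Fin n) (Fin n) ℂ :=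
  fun j k => g (e.symm z) (coordVector e z j) (coordVector e z k)

/-- The coordinates of the points of `U` in the chart `e`. -/
def coordDomain {n : ℕ} {X : Type*} [TopologicalSpace X]
    (e : OpenPartialHomeomorph X (Fin n → ℂ)) (U : Set X) : Set (Fin n → ℂ) :=
  e.target ∩ e.symm ⁻¹' U

/-- `g` is a (smooth) hermitian metric on the open subset `U`. -/
structure PairingField.IsHermitianMetricOn {n : ℕ} {X : Type*} [TopologicalSpace X]
    [ChartedSpace (Fin n → ℂ) X] (g : PairingField n X) (U : Set X) : Prop where
  isOpen : IsOpen U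
  add_left : ∀ x ∈ U, ∀ u u' v, g x (u + u') v = g x u v + g x u' v
  smul_left : ∀ x ∈ U, ∀ (c : ℂ) u v, g x (c • u) v = c * g x u v
  conj_symm : ∀ x ∈ U, ∀ u v, g x v u = starRingEnd ℂ (g x u v)
  pos : ∀ x ∈ U, ∀ u, u ≠ 0 → 0 < (g x u u).re
  smooth : ∀ e ∈ holCharts n X, ∀ j k,
    ContDiffOn ℝ ∞ (fun z => g.matrix e z j k) (coordDomain e U)

/-- The alternating form `∑ A_{jk} dzʲ ∧ dz̄ᵏ` on `ℂⁿ`. -/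
def form11 {n : ℕ} (A : Matrix (Fin n) (Fin n) ℂ) : (Fin n → ℂ) [⋀^Fin 2]→L[ℝ] ℂ where
  toFun v := ∑ j, ∑ k, A j k *
    (v 0 j * starRingEnd ℂ (v 1 k) - v 1 j * starRingEnd ℂ (v 0 k))
  map_update_add' := by
    intro _ m i x y
    rw [← Finset.sum_add_distrib]
    refine Finset.sum_congr rfl fun j _ => ?_
    rw [← Finset.sum_add_distrib]
    refine Finset.sum_congr rfl fun k _ => ?_
    fin_cases i <;> simp [Function.update] <;> ring
  map_update_smul' := by
    intro _ m i c x
    rw [Finset.smul_sum]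
    refine Finset.sum_congr rfl fun j _ => ?_
    rw [Finset.smul_sum]
    refine Finset.sum_congr rfl fun k _ => ?_
    fin_cases i <;> simp [Function.update] <;> ring
  map_eq_zero_of_eq' := by
    intro v i j h hij
    have h01 : v 0 = v 1 := by
      fin_cases i <;> fin_cases j <;> simp_all
    simp [h01]
  cont := by
    have h : ∀ (i : Fin 2) (j : Fin n), Continuous fun v : Fin 2 → Fin n → ℂ => v i j :=
      fun i j => (continuous_apply j).comp (continuous_apply i)
    refine continuous_finsetSum _ fun j _ => continuous_finsetSum _ fun k _ => ?_
    exact continuous_const.mul (((h 0 j).mul (Complex.continuous_conj.comp (h 1 k))).sub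
      ((h 1 j).mul (Complex.continuous_conj.comp (h 0 k))))

/-- The fundamental form `(i/2) ∑ g_{jk} dzʲ ∧ dz̄ᵏ` of `g` in the chart `e`. -/
def PairingField.fundamentalForm {n : ℕ} {X : Type*} [TopologicalSpace X]
    [ChartedSpace (Fin n → ℂ) X] (g : PairingField n X)
    (e : OpenPartialHomeomorph X (Fin n → ℂ)) (z : Fin n → ℂ) : (Fin n → ℂ) [⋀^Fin 2]→L[ℝ] ℂ :=
  form11 ((Complex.I / 2) • g.matrix e z)

/-- The metric `g` is Kähler on `U`: its fundamental form is closed. -/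
def PairingField.IsKahlerOn {n : ℕ} {X : Type*} [TopologicalSpace X]
    [ChartedSpace (Fin n → ℂ) X] (g : PairingField n X) (U : Set X) : Prop :=
  ∀ e ∈ holCharts n X, ∀ z ∈ coordDomain e U, extDeriv (g.fundamentalForm e) z = 0

/-- The Wirtinger derivative `∂f/∂zʲ`. -/
def wirtinger {n : ℕ} (j : Fin n) (f : (Fin n → ℂ) → ℂ) (z : Fin n → ℂ) : ℂ :=
  (fderiv ℝ f z (Pi.single j 1) - Complex.I * fderiv ℝ f z (Pi.single j Complex.I)) / 2

/-- The Wirtinger derivative `∂f/∂z̄ʲ`. -/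
def wirtingerBar {n : ℕ} (j : Fin n) (f : (Fin n → ℂ) → ℂ) (z : Fin n → ℂ) : ℂ :=
  (fderiv ℝ f z (Pi.single j 1) + Complex.I * fderiv ℝ f z (Pi.single j Complex.I)) / 2

/-- `log det g` in the chart `e` (the determinant of a hermitian metric is a positive real). -/
def PairingField.logDet {n : ℕ} {X : Type*} [TopologicalSpace X] [ChartedSpace (Fin n → ℂ) X]
    (g : PairingField n X) (e : OpenPartialHomeomorph X (Fin n → ℂ)) (z : Fin n → ℂ) : ℂ :=
  ((Real.log (g.matrix e z).det.re : ℝ) : ℂ)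

/-- The Ricci form `(i/2π) ∂∂̄ log det g` of the hermitian metric `g` in the chart `e`. -/
def PairingField.ricciForm {n : ℕ} {X : Type*} [TopologicalSpace X] [ChartedSpace (Fin n → ℂ) X]
    (g : PairingField n X) (e : OpenPartialHomeomorph X (Fin n → ℂ)) (z : Fin n → ℂ) :
    (Fin n → ℂ) [⋀^Fin 2]→L[ℝ] ℂ :=
  form11 ((Complex.I / (2 * (Real.pi : ℂ))) •
    Matrix.of fun j k => wirtinger j (wirtingerBar k (g.logDet e)) z)

/-- The metric `g` is Ricci-flat on `U`. -/
def PairingField.IsRicciFlatOn {n : ℕ} {X : Type*} [TopologicalSpace X]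
    [ChartedSpace (Fin n → ℂ) X] (g : PairingField n X) (U : Set X) : Prop :=
  ∀ e ∈ holCharts n X, ∀ z ∈ coordDomain e U, g.ricciForm e z = 0

/-! ### Objects attached to a family of `n` holomorphic vector fields -/

section Frame

variable {n : ℕ} {X : Type*} [TopologicalSpace X] [ChartedSpace (Fin n → ℂ) X]
  [IsManifold 𝓘(ℂ, Fin n → ℂ) ω X]

/-- The fields `s` generate the tangent space at `x`. -/
def GenerateAt (s : Fin n → HolVectorField n X) (x : X) : Prop :=
  Submodule.span ℂ (Set.range fun i => s i x) = ⊤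

/-- The fields `s` generate `T_X` at the general point, i.e. on a dense open subset. -/
def GenerateAtGeneralPoint (s : Fin n → HolVectorField n X) : Prop :=
  ∃ U : Set X, IsOpen U ∧ Dense U ∧ ∀ x ∈ U, GenerateAt s x

/-- The wedge product `s⁽¹⁾ ∧ … ∧ s⁽ⁿ⁾`. -/
def wedge (s : Fin n → HolVectorField n X) : MultivectorField n X :=
  fun x => exteriorPower.ιMulti ℂ n (fun i => s i x)

open Classical in
/-- The dual frame: where the `s i` form a basis of the tangent space, `dualFrame s x i` is the
`i`-th member of the dual basis (and it is `0` elsewhere). -/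
def dualFrame (s : Fin n → HolVectorField n X) (x : X) (i : Fin n) :
    TangentSpace 𝓘(ℂ, Fin n → ℂ) x →ₗ[ℂ] ℂ :=
  if h : LinearIndependent ℂ (fun i => s i x) ∧
      ⊤ ≤ Submodule.span ℂ (Set.range fun i => s i x) then
    (Module.Basis.mk h.1 h.2).coord i
  else 0

/-- The metric `g_B` for which the frame `s` is unitary: `g_B(u ⊗ v̄) = ∑ᵢ sᵢ(u) · conj (sᵢ(v))`,
where the `sᵢ` are the dual frame. -/
def frameMetric (s : Fin n → HolVectorField n X) : PairingField n X :=
  fun x u v => ∑ i, dualFrame s x i u * starRingEnd ℂ (dualFrame s x i v)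

/-- Where the `s i` generate the tangent space, `g_B(s⁽ⁱ⁾ ⊗ conj s⁽ʲ⁾) = δᵢⱼ`. -/
theorem frameMetric_apply (s : Fin n → HolVectorField n X) {x : X} (hx : GenerateAt s x)
    (i j : Fin n) : frameMetric s x (s i x) (s j x) = if i = j then 1 else 0 := by
  classical
  have hd : Module.finrank ℂ (TangentSpace 𝓘(ℂ, Fin n → ℂ) x) = n :=
    Module.finrank_fin_fun ℂ
  have hli : LinearIndependent ℂ (fun i => s i x) :=
    linearIndependent_of_top_le_span_of_card_eq_finrank (le_of_eq hx.symm) (by simp [hd])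
  have h : LinearIndependent ℂ (fun i => s i x) ∧
      ⊤ ≤ Submodule.span ℂ (Set.range fun i => s i x) := ⟨hli, le_of_eq hx.symm⟩
  have key : ∀ k l, dualFrame s x k (s l x) = if k = l then 1 else 0 := by
    intro k l
    have hl : s l x = Module.Basis.mk h.1 h.2 l := by simp
    rw [dualFrame, dif_pos h, hl, Module.Basis.coord_apply, Module.Basis.repr_self,
      Finsupp.single_apply]
    simp [eq_comm]
  simp [frameMetric, key, eq_comm]

/-- A space `V` of holomorphic vector fields is abelian if all Lie brackets of its members
vanish. -/
def IsAbelianSpace (V : Submodule ℂ (HolVectorField n X)) : Prop :=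
  ∀ ζ ∈ V, ∀ ξ ∈ V, ∀ x : X,
    VectorField.mlieBracket 𝓘(ℂ, Fin n → ℂ) (fun y => ζ y) (fun y => ξ y) x = 0

end Frame

end FrameGeometry

end

/-! In a holomorphic chart the fields become the rows of a holomorphic matrix M (`frameMatrix`), and
everything is read off from M. The coefficient of the wedge product is det M. Changing the chart
multiplies it by a nowhere zero Jacobian determinant (`frameMatrix_transition`); changing the family
that spans V multiplies it by a constant (`coeff_wedge_span`), nonzero because both families
generate at some point. Hence these coefficients define a single effective divisor, and det M
vanishes exactly where the fields fail to generate (`generateAt_symm_iff`).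

Off the divisor the metric has matrix M⁻¹(M⁻¹)* (`matrix_frameMetric`). Its determinant is |h|² with
h = det M⁻¹ holomorphic without zeros, and log |h|² is pluriharmonic
(`wirtinger_wirtingerBar_log_normSq`); this is Ricci-flatness.

Let θⁱ be the dual coframe, given by the columns of M⁻¹. The fundamental form is (i/2) ∑ θⁱ ∧ conj
θⁱ. As θⁱ is holomorphic, the differential splits into a (2,1) part with terms dθⁱ ∧ conj θⁱ and a
conjugate (1,2) part. These vanish separately and the conj θⁱ are independent, so the form is closed
iff every dθⁱ = 0 (`extDeriv_sum_wedge_conj_eq_zero_iff`). By Cartan's formula (`extDerivOne_frame`)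
this means that all brackets of the frame vanish. Commutation off the divisor extends to X by
density and continuity (`mlieBracket_eq_zero_of_dense`). -/

open scoped Topology

noncomputable section

namespace FrameGeometry

/-! ### Wirtinger calculus and pluriharmonicity of log |h|². -/

section Analysis

variable {n : ℕ}

theorem wirtingerBar_congr {f g : (Fin n → ℂ) → ℂ} {z : Fin n → ℂ} (j : Fin n)
    (h : f =ᶠ[𝓝 z] g) : wirtingerBar j f z = wirtingerBar j g z := by
  simp only [wirtingerBar, h.fderiv_eq]

theorem wirtinger_congr {f g : (Fin n → ℂ) → ℂ} {z : Fin n → ℂ} (j : Fin n)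
    (h : f =ᶠ[𝓝 z] g) : wirtinger j f z = wirtinger j g z := by
  simp only [wirtinger, h.fderiv_eq]

theorem single_I (j : Fin n) :
    (Pi.single j Complex.I : Fin n → ℂ) = Complex.I • (Pi.single j 1 : Fin n → ℂ) := by
  rw [← Pi.single_smul]; simp

/-- An antiholomorphic function is annihilated by `∂/∂zʲ`. -/
theorem wirtinger_conj {q : (Fin n → ℂ) → ℂ} {z : Fin n → ℂ} (j : Fin n)
    (hq : DifferentiableAt ℂ q z) :
    wirtinger j (fun y => starRingEnd ℂ (q y)) z = 0 := by
  have h : HasFDerivAt (fun y => starRingEnd ℂ (q y))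
      ((Complex.conjCLE : ℂ →L[ℝ] ℂ).comp ((fderiv ℂ q z).restrictScalars ℝ)) z :=
    (Complex.conjCLE : ℂ →L[ℝ] ℂ).hasFDerivAt.comp z (hq.hasFDerivAt.restrictScalars ℝ)
  rw [wirtinger, h.fderiv, single_I]
  simp only [ContinuousLinearMap.comp_apply, ContinuousLinearMap.coe_restrictScalars',
    map_smul, smul_eq_mul, ContinuousLinearEquiv.coe_coe, Complex.conjCLE_apply, map_mul,
    Complex.conj_I]
  linear_combination (starRingEnd ℂ) ((fderiv ℂ q z) (Pi.single j 1)) / 2 * Complex.I_mul_I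

/-- `∂/∂z̄ʲ log |h|² = conj (∂h/∂zʲ / h)` for a holomorphic function `h` without zeros. -/
theorem wirtingerBar_log_normSq {h : (Fin n → ℂ) → ℂ} {z : Fin n → ℂ} (j : Fin n)
    (hh : DifferentiableAt ℂ h z) (hz : h z ≠ 0) :
    wirtingerBar j (fun y => ((Real.log (Complex.normSq (h y)) : ℝ) : ℂ)) z =
      starRingEnd ℂ (fderiv ℂ h z (Pi.single j 1) / h z) := by
  have hR : HasFDerivAt h ((fderiv ℂ h z).restrictScalars ℝ) z :=
    hh.hasFDerivAt.restrictScalars ℝ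
  have hre : HasFDerivAt (fun y => (h y).re)
      (Complex.reCLM.comp ((fderiv ℂ h z).restrictScalars ℝ)) z :=
    Complex.reCLM.hasFDerivAt.comp z hR
  have him : HasFDerivAt (fun y => (h y).im)
      (Complex.imCLM.comp ((fderiv ℂ h z).restrictScalars ℝ)) z :=
    Complex.imCLM.hasFDerivAt.comp z hR
  have h0 : (h z).re * (h z).re + (h z).im * (h z).im ≠ 0 := by
    simpa [Complex.normSq_apply] using (Complex.normSq_pos.2 hz).ne'
  have hF := Complex.ofRealCLM.hasFDerivAt.comp z
    (HasFDerivAt.log (f := fun y => (h y).re * (h y).re + (h y).im * (h y).im)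
      ((hre.mul hre).add (him.mul him)) h0)
  have e : (fun y => ((Real.log (Complex.normSq (h y)) : ℝ) : ℂ)) =
      Complex.ofRealCLM ∘ fun y => Real.log ((h y).re * (h y).re + (h y).im * (h y).im) := by
    ext y; simp [Complex.normSq_apply]
  -- The logarithmic derivative: d log |h|² = 2 Re (dh / h).
  have key : ∀ v, fderiv ℝ (fun y => ((Real.log (Complex.normSq (h y)) : ℝ) : ℂ)) z v =
      ((2 * (fderiv ℂ h z v / h z).re : ℝ) : ℂ) := by
    intro v
    rw [e, hF.fderiv]
    simp only [ContinuousLinearMap.comp_apply, smul_apply,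
      add_apply, Complex.ofRealCLM_apply, Complex.reCLM_apply,
      Complex.imCLM_apply, ContinuousLinearMap.coe_restrictScalars', smul_eq_mul,
      Complex.div_re, Complex.normSq_apply]
    congr 1
    field_simp
    ring
  -- With w = ∂h/h, complex linearity of dh reduces the claim to Re w + i Re (i w) = conj w.
  rw [wirtingerBar, key, key, single_I, map_smul, smul_eq_mul, mul_div_assoc]
  generalize fderiv ℂ h z (Pi.single j 1) / h z = w
  apply Complex.ext
  · simp
  · simp
    ring

/-- `log |h|²` is pluriharmonic for a holomorphic function `h` without zeros. -/
theorem wirtinger_wirtingerBar_log_normSq {h : (Fin n → ℂ) → ℂ} {U : Set (Fin n → ℂ)}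
    (hU : IsOpen U) (hh : ContDiffOn ℂ ω h U) (h0 : ∀ z ∈ U, h z ≠ 0) {z : Fin n → ℂ} (hz : z ∈ U)
    (j k : Fin n) :
    wirtinger j (wirtingerBar k (fun y => ((Real.log (Complex.normSq (h y)) : ℝ) : ℂ))) z = 0 := by
  have hd : ∀ y ∈ U, DifferentiableAt ℂ h y := fun y hy =>
    (hh.contDiffAt (hU.mem_nhds hy)).differentiableAt (by simp)
  -- Near z the inner derivative is the conjugate of the holomorphic function ∂ₖh / h, which ∂/∂zʲ
  -- annihilates.
  rw [wirtinger_congr j (g := fun y => starRingEnd ℂ (fderiv ℂ h y (Pi.single k 1) / h y))]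
  · simp only [div_eq_mul_inv]
    refine wirtinger_conj j (DifferentiableAt.fun_mul ?_ ((hd z hz).fun_inv (h0 z hz)))
    have := (hh.contDiffAt (hU.mem_nhds hz)).fderiv_right (m := 1) (by simp)
    exact (this.differentiableAt (by simp)).clm_apply (differentiableAt_const _)
  · filter_upwards [hU.mem_nhds hz] with y hy
    exact wirtingerBar_log_normSq k (hd y hy) (h0 y hy)

end Analysis

/-! ### Holomorphic coframes: closedness and brackets. -/

section Coframe

variable {n : ℕ} {θ : Fin n → (Fin n → ℂ) → ((Fin n → ℂ) →L[ℂ] ℂ)} {z : Fin n → ℂ}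

/-- The exterior derivative of a `1`-form at a point. -/
def extDerivOne (τ : (Fin n → ℂ) → ((Fin n → ℂ) →L[ℂ] ℂ)) (z u v : Fin n → ℂ) : ℂ :=
  fderiv ℂ τ z u v - fderiv ℂ τ z v u

theorem extDerivOne_smul_left (τ : (Fin n → ℂ) → ((Fin n → ℂ) →L[ℂ] ℂ)) (z u v : Fin n → ℂ)
    (c : ℂ) : extDerivOne τ z (c • u) v = c * extDerivOne τ z u v := by
  simp [extDerivOne, mul_sub]

theorem extDerivOne_smul_right (τ : (Fin n → ℂ) → ((Fin n → ℂ) →L[ℂ] ℂ)) (z u v : Fin n → ℂ)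
    (c : ℂ) : extDerivOne τ z u (c • v) = c * extDerivOne τ z u v := by
  simp [extDerivOne, mul_sub]

theorem extDerivOne_sum_smul {ι : Type*} [Fintype ι]
    (τ : (Fin n → ℂ) → ((Fin n → ℂ) →L[ℂ] ℂ)) (z : Fin n → ℂ) (a : ι → Fin n → ℂ) (b c : ι → ℂ) :
    extDerivOne τ z (∑ j, b j • a j) (∑ k, c k • a k) =
      ∑ j, ∑ k, b j * (c k * extDerivOne τ z (a j) (a k)) := by
  simp only [extDerivOne, map_sum, map_smul, sum_apply,
    smul_apply, smul_eq_mul, Finset.mul_sum, mul_sub, Finset.sum_sub_distrib]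
  congr 1
  rw [Finset.sum_comm]
  exact Finset.sum_congr rfl fun j _ => Finset.sum_congr rfl fun k _ => by ring

/-- The differential of `c ∑ θⁱ ∧ conj θⁱ` in terms of the differentials of the `θⁱ`. -/
theorem extDeriv_sum_wedge_conj (hθ : ∀ i, DifferentiableAt ℂ (θ i) z)
    {F : (Fin n → ℂ) → (Fin n → ℂ) [⋀^Fin 2]→L[ℝ] ℂ} (hF : DifferentiableAt ℝ F z) (c : ℂ)
    (hFθ : ∀ y v, F y v = c * ∑ i, (θ i y (v 0) * starRingEnd ℂ (θ i y (v 1)) -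
      θ i y (v 1) * starRingEnd ℂ (θ i y (v 0)))) (u v w : Fin n → ℂ) :
    extDeriv F z ![u, v, w] = c * ∑ i,
      (extDerivOne (θ i) z u v * starRingEnd ℂ (θ i z w) +
        extDerivOne (θ i) z v w * starRingEnd ℂ (θ i z u) +
        extDerivOne (θ i) z w u * starRingEnd ℂ (θ i z v) -
        starRingEnd ℂ (extDerivOne (θ i) z u v) * θ i z w -
        starRingEnd ℂ (extDerivOne (θ i) z v w) * θ i z u -
        starRingEnd ℂ (extDerivOne (θ i) z w u) * θ i z v) := by
  have h1 : ∀ i v, HasFDerivAt (fun y => θ i y v)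
      (((fderiv ℂ (θ i) z).flip v).restrictScalars ℝ) z := fun i v =>
    HasFDerivAt.restrictScalars ℝ ((hθ i).hasFDerivAt.clm_apply (hasFDerivAt_const v z) |>.congr_fderiv
      (by ext; simp))
  have h2 : ∀ i v, HasFDerivAt (fun y => starRingEnd ℂ (θ i y v))
      ((Complex.conjCLE : ℂ →L[ℝ] ℂ).comp (((fderiv ℂ (θ i) z).flip v).restrictScalars ℝ)) z :=
    fun i v => (Complex.conjCLE : ℂ →L[ℝ] ℂ).hasFDerivAt.comp z (h1 i v)
  have key : ∀ x (v : Fin 2 → Fin n → ℂ), fderiv ℝ F z x v = c * ∑ i,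
      (fderiv ℂ (θ i) z x (v 0) * starRingEnd ℂ (θ i z (v 1)) +
        θ i z (v 0) * starRingEnd ℂ (fderiv ℂ (θ i) z x (v 1)) -
        fderiv ℂ (θ i) z x (v 1) * starRingEnd ℂ (θ i z (v 0)) -
        θ i z (v 1) * starRingEnd ℂ (fderiv ℂ (θ i) z x (v 0))) := by
    intro x v
    have e1 := (hF.hasFDerivAt.continuousAlternatingMap_apply_const v)
    have e3 := fun i => ((h1 i (v 0)).fun_mul (h2 i (v 1))).fun_sub
      ((h1 i (v 1)).fun_mul (h2 i (v 0)))
    have e2 := (HasFDerivAt.fun_sum (u := Finset.univ) fun i _ => e3 i).const_mul c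
    simp only [← hFθ] at e2
    have := congrArg (fun L => L x) (e1.unique e2)
    simp only [ContinuousLinearMap.flipAlternating_apply_apply] at this
    rw [this]
    simp only [smul_apply, sum_apply, smul_eq_mul,
      sub_apply, add_apply,
      ContinuousLinearMap.comp_apply, ContinuousLinearMap.coe_restrictScalars',
      ContinuousLinearMap.flip_apply, ContinuousLinearEquiv.coe_coe, Complex.conjCLE_apply]
    congr 1
    exact Finset.sum_congr rfl fun i _ => by ring
  rw [extDeriv, ContinuousAlternatingMap.alternatizeUncurryFin_apply, Fin.sum_univ_three]
  simp only [key, Fin.removeNth_apply]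
  have f1 : Fin.succAbove (0 : Fin 3) (0 : Fin 2) = 1 := rfl
  have f2 : Fin.succAbove (0 : Fin 3) (1 : Fin 2) = 2 := rfl
  have f3 : Fin.succAbove (1 : Fin 3) (0 : Fin 2) = 0 := rfl
  have f4 : Fin.succAbove (1 : Fin 3) (1 : Fin 2) = 2 := rfl
  have f5 : Fin.succAbove (2 : Fin 3) (0 : Fin 2) = 0 := rfl
  have f6 : Fin.succAbove (2 : Fin 3) (1 : Fin 2) = 1 := rfl
  have g0 : (![u, v, w] : Fin 3 → Fin n → ℂ) 0 = u := rfl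
  have g1 : (![u, v, w] : Fin 3 → Fin n → ℂ) 1 = v := rfl
  have g2 : (![u, v, w] : Fin 3 → Fin n → ℂ) 2 = w := rfl
  simp only [f1, f2, f3, f4, f5, f6, g0, g1, g2, Fin.val_zero, Fin.val_one, Fin.val_two,
    pow_zero, pow_one, one_smul, neg_one_sq, neg_smul, ← sub_eq_add_neg]
  rw [← mul_sub, ← mul_add, ← Finset.sum_sub_distrib, ← Finset.sum_add_distrib]
  congr 1
  refine Finset.sum_congr rfl fun i _ => ?_
  simp only [extDerivOne, map_sub]
  ring

/-- If the `θⁱ` form a coframe, then `c ∑ θⁱ ∧ conj θⁱ` is closed iff the `θⁱ` are closed. -/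
theorem extDeriv_sum_wedge_conj_eq_zero_iff (hθ : ∀ i, DifferentiableAt ℂ (θ i) z)
    {F : (Fin n → ℂ) → (Fin n → ℂ) [⋀^Fin 2]→L[ℝ] ℂ} (hF : DifferentiableAt ℝ F z) {c : ℂ}
    (hc : c ≠ 0)
    (hFθ : ∀ y v, F y v = c * ∑ i, (θ i y (v 0) * starRingEnd ℂ (θ i y (v 1)) -
      θ i y (v 1) * starRingEnd ℂ (θ i y (v 0))))
    {a : Fin n → Fin n → ℂ} (ha : ∀ i j, θ i z (a j) = if i = j then 1 else 0) :
    extDeriv F z = 0 ↔ ∀ i u v, extDerivOne (θ i) z u v = 0 := by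
  have key := extDeriv_sum_wedge_conj hθ hF c hFθ
  constructor
  · intro h i u v
    have h' : ∀ u v w, ∑ i,
      (extDerivOne (θ i) z u v * starRingEnd ℂ (θ i z w) +
        extDerivOne (θ i) z v w * starRingEnd ℂ (θ i z u) +
        extDerivOne (θ i) z w u * starRingEnd ℂ (θ i z v) -
        starRingEnd ℂ (extDerivOne (θ i) z u v) * θ i z w -
        starRingEnd ℂ (extDerivOne (θ i) z v w) * θ i z u -
        starRingEnd ℂ (extDerivOne (θ i) z w u) * θ i z v) = 0 := by
      intro u v w
      have := key u v w
      rw [h] at this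
      simpa [hc] using this.symm
    -- With S(u, v) the vanishing sum for w = `a i`, the combination S(u,v) - i S(iu,v) - i S(u,iv)
    -- - S(iu,iv) isolates the part that is complex bilinear in (u, v): that part is multiplied by
    -- 4, and every term antilinear in u or v cancels. Duality at `a i` then leaves only the index
    -- `i`.
    have h4 : 4 * ∑ l, extDerivOne (θ l) z u v * starRingEnd ℂ (θ l z (a i)) = 0 := by
      have := congrArg₂ (· - ·) (congrArg₂ (· - ·) (congrArg₂ (· - ·) (h' u v (a i))
        (congrArg (Complex.I * ·) (h' (Complex.I • u) v (a i))))
        (congrArg (Complex.I * ·) (h' u (Complex.I • v) (a i))))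
        (h' (Complex.I • u) (Complex.I • v) (a i))
      simp only [Finset.mul_sum, ← Finset.sum_sub_distrib, mul_zero, sub_zero] at this
      rw [Finset.mul_sum, ← this]
      refine Finset.sum_congr rfl fun l _ => ?_
      simp only [extDerivOne_smul_left, extDerivOne_smul_right, map_smul, smul_eq_mul, map_mul,
        Complex.conj_I]
      generalize extDerivOne (θ l) z u v = p
      generalize extDerivOne (θ l) z v (a i) = q
      generalize extDerivOne (θ l) z (a i) u = r
      generalize θ l z (a i) = x
      linear_combination (3 * (p * starRingEnd ℂ x) - q * starRingEnd ℂ (θ l z u)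
        - r * starRingEnd ℂ (θ l z v) + starRingEnd ℂ p * x + starRingEnd ℂ q * θ l z u
        + starRingEnd ℂ r * θ l z v) * Complex.I_mul_I
    simpa [ha] using h4
  · intro h
    ext v
    have : v = ![v 0, v 1, v 2] := by ext i; fin_cases i <;> rfl
    rw [this, key]
    simp [h]

/-- Cartan's formula `dθⁱ(aⱼ, aₖ) = -θⁱ([aⱼ, aₖ])` for a frame `a` with dual coframe `θ`. -/
theorem extDerivOne_frame {a : Fin n → (Fin n → ℂ) → Fin n → ℂ}
    (hθ : ∀ i, DifferentiableAt ℂ (θ i) z) (hd : ∀ i, DifferentiableAt ℂ (a i) z)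
    (ha : ∀ᶠ y in 𝓝 z, ∀ i j, θ i y (a j y) = if i = j then 1 else 0) (i j k : Fin n) :
    extDerivOne (θ i) z (a j z) (a k z) = -θ i z (VectorField.lieBracket ℂ (a j) (a k) z) := by
  -- Differentiating the constant function θⁱ(aₖ) = δᵢₖ in the direction `x`.
  have h : ∀ k x, fderiv ℂ (θ i) z x (a k z) + θ i z (fderiv ℂ (a k) z x) = 0 := by
    intro k x
    have e1 := (hθ i).hasFDerivAt.clm_apply (hd k).hasFDerivAt
    have e2 : HasFDerivAt (fun y => θ i y (a k y)) (0 : (Fin n → ℂ) →L[ℂ] ℂ) z :=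
      (hasFDerivAt_const (if i = k then (1 : ℂ) else 0) z).congr_of_eventuallyEq
        (ha.mono fun y hy => hy i k)
    have := congrArg (fun L => L x) (e1.unique e2)
    simp at this
    linear_combination this
  simp only [extDerivOne, VectorField.lieBracket, map_sub]
  linear_combination h k (a j z) - h j (a k z)

/-- A 2-form is determined by its values on the frame, and a vector by its θ-coordinates, so
Cartan's formula turns closedness of all the θⁱ into vanishing of the brackets. -/
theorem extDerivOne_eq_zero_iff {a : Fin n → (Fin n → ℂ) → Fin n → ℂ}
    (hθ : ∀ i, DifferentiableAt ℂ (θ i) z) (hd : ∀ i, DifferentiableAt ℂ (a i) z)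
    (ha : ∀ᶠ y in 𝓝 z, ∀ i j, θ i y (a j y) = if i = j then 1 else 0)
    (hspan : ∀ v, v = ∑ i, θ i z v • a i z) :
    (∀ i u v, extDerivOne (θ i) z u v = 0) ↔
      ∀ j k, VectorField.lieBracket ℂ (a j) (a k) z = 0 := by
  have key := extDerivOne_frame hθ hd ha
  constructor
  · intro h j k
    rw [hspan (VectorField.lieBracket ℂ (a j) (a k) z)]
    refine Finset.sum_eq_zero fun i _ => ?_
    have := key i j k
    rw [h] at this
    rw [neg_eq_zero.1 this.symm, zero_smul]
  · intro h i u v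
    rw [hspan u, hspan v, extDerivOne_sum_smul]
    simp [key, h]

end Coframe

/-! ### Holomorphic vector fields and their brackets in charts. -/

theorem inverse_apply_eq_zero_iff {E F : Type*} [TopologicalSpace E] [AddCommGroup E]
    [Module ℂ E] [TopologicalSpace F] [AddCommGroup F] [Module ℂ F]
    {L : E →L[ℂ] F} (h : L.IsInvertible) {v : F} :
    L.inverse v = 0 ↔ v = 0 := by
  obtain ⟨M, rfl⟩ := h
  rw [ContinuousLinearMap.inverse_equiv]
  exact M.symm.map_eq_zero_iff

section Charts

variable {n : ℕ} {X : Type*} [TopologicalSpace X] [ChartedSpace (Fin n → ℂ) X]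
  [IsManifold 𝓘(ℂ, Fin n → ℂ) ω X] {e : OpenPartialHomeomorph X (Fin n → ℂ)}

omit [IsManifold 𝓘(ℂ, Fin n → ℂ) ω X] in
theorem mdifferentiable_of_mem_holCharts (he : e ∈ holCharts n X) :
    e.MDifferentiable 𝓘(ℂ, Fin n → ℂ) 𝓘(ℂ, Fin n → ℂ) :=
  ⟨(contMDiffOn_of_mem_maximalAtlas he).mdifferentiableOn (by simp),
    (contMDiffOn_symm_of_mem_maximalAtlas he).mdifferentiableOn (by simp)⟩

/-- The vector field `V` in the chart `e`, as a function of the coordinates. -/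
def coordField (e : OpenPartialHomeomorph X (Fin n → ℂ)) (V : HolVectorField n X) :
    (Fin n → ℂ) → Fin n → ℂ :=
  VectorField.mpullback 𝓘(ℂ, Fin n → ℂ) 𝓘(ℂ, Fin n → ℂ) e.symm (fun y => V y)

omit [IsManifold 𝓘(ℂ, Fin n → ℂ) ω X] in
theorem isInvertible_mfderiv_symm (he : e ∈ holCharts n X) {z : Fin n → ℂ} (hz : z ∈ e.target) :
    (mfderiv 𝓘(ℂ, Fin n → ℂ) 𝓘(ℂ, Fin n → ℂ) e.symm z).IsInvertible :=
  ⟨(mdifferentiable_of_mem_holCharts he).symm.mfderiv hz, rfl⟩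

theorem mfderiv_symm_coordField (he : e ∈ holCharts n X) (V : HolVectorField n X)
    {z : Fin n → ℂ} (hz : z ∈ e.target) :
    mfderiv 𝓘(ℂ, Fin n → ℂ) 𝓘(ℂ, Fin n → ℂ) e.symm z (coordField e V z) = V (e.symm z) :=
  (isInvertible_mfderiv_symm he hz).self_apply_inverse _

theorem coordField_eq_mfderiv (he : e ∈ holCharts n X) (V : HolVectorField n X)
    {z : Fin n → ℂ} (hz : z ∈ e.target) :
    coordField e V z =
      mfderiv 𝓘(ℂ, Fin n → ℂ) 𝓘(ℂ, Fin n → ℂ) e (e.symm z) (V (e.symm z)) := by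
  rw [← mfderiv_symm_coordField he V hz]
  exact (congrArg (fun L => L (coordField e V z))
    ((mdifferentiable_of_mem_holCharts he).comp_symm_deriv hz)).symm

theorem contDiffOn_coordField (he : e ∈ holCharts n X) (V : HolVectorField n X) :
    ContDiffOn ℂ ω (coordField e V) e.target := by
  intro z hz
  have h := ContMDiffAt.mpullback_vectorField_preimage (m := ω) (n := ω)
    (V.contMDiff (e.symm z)) (contMDiffAt_symm_of_mem_maximalAtlas he hz)
    (isInvertible_mfderiv_symm he hz) le_rfl
  exact (contMDiffAt_vectorSpace_iff_contDiffAt.1 h).contDiffWithinAt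

theorem mdifferentiableAt_section (V : HolVectorField n X) (x : X) :
    MDifferentiableAt 𝓘(ℂ, Fin n → ℂ) (𝓘(ℂ, Fin n → ℂ).prod 𝓘(ℂ, Fin n → ℂ))
      (fun y => (⟨y, V y⟩ : TangentBundle 𝓘(ℂ, Fin n → ℂ) X)) x :=
  (V.contMDiff x).mdifferentiableAt (by simp)

/-- Naturality of the bracket under pullback by the inverse chart, together with the fact that on ℂⁿ
the manifold bracket is the usual one. -/
theorem lieBracket_coordField (he : e ∈ holCharts n X) (V W : HolVectorField n X)
    {z : Fin n → ℂ} (hz : z ∈ e.target) :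
    VectorField.lieBracket ℂ (coordField e V) (coordField e W) z =
      (mfderiv 𝓘(ℂ, Fin n → ℂ) 𝓘(ℂ, Fin n → ℂ) e.symm z).inverse
        (VectorField.mlieBracket 𝓘(ℂ, Fin n → ℂ) (fun y => V y) (fun y => W y) (e.symm z)) := by
  have : IsManifold 𝓘(ℂ, Fin n → ℂ) (minSmoothness ℂ 3) X := IsManifold.of_le le_top
  have h := VectorField.mpullback_mlieBracket (mdifferentiableAt_section V (e.symm z))
    (mdifferentiableAt_section W (e.symm z)) (contMDiffAt_symm_of_mem_maximalAtlas he hz)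
    (by simp)
  have hE : ∀ A B : (x : Fin n → ℂ) → TangentSpace 𝓘(ℂ, Fin n → ℂ) x,
      VectorField.mlieBracket 𝓘(ℂ, Fin n → ℂ) A B = VectorField.lieBracket ℂ A B := fun A B => by
    rw [← VectorField.mlieBracketWithin_univ, VectorField.mlieBracketWithin_eq_lieBracketWithin]
    exact VectorField.lieBracketWithin_univ
  exact (h.trans (congrFun (hE _ _) z)).symm

theorem lieBracket_coordField_eq_zero_iff (he : e ∈ holCharts n X) (V W : HolVectorField n X)
    {z : Fin n → ℂ} (hz : z ∈ e.target) :
    VectorField.lieBracket ℂ (coordField e V) (coordField e W) z = 0 ↔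
      VectorField.mlieBracket 𝓘(ℂ, Fin n → ℂ) (fun y => V y) (fun y => W y) (e.symm z) = 0 := by
  rw [lieBracket_coordField he V W hz]
  exact inverse_apply_eq_zero_iff (isInvertible_mfderiv_symm he hz)

theorem continuousOn_lieBracket_coordField (he : e ∈ holCharts n X) (V W : HolVectorField n X) :
    ContinuousOn (VectorField.lieBracket ℂ (coordField e V) (coordField e W)) e.target := by
  have h : ∀ V : HolVectorField n X, ContinuousOn (fderiv ℂ (coordField e V)) e.target :=
    fun V => (contDiffOn_coordField he V).continuousOn_fderiv_of_isOpen e.open_target (by simp)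
  exact ((h W).clm_apply (contDiffOn_coordField he V).continuousOn).sub
    ((h V).clm_apply (contDiffOn_coordField he W).continuousOn)

theorem exists_mem_holCharts (x : X) : ∃ e ∈ holCharts n X, x ∈ e.source :=
  ⟨chartAt _ x, IsManifold.chart_mem_maximalAtlas x, mem_chart_source _ x⟩

/-- If the bracket of two holomorphic vector fields vanishes on a dense set, it vanishes. -/
theorem mlieBracket_eq_zero_of_dense {U : Set X} (hU : Dense U) (V W : HolVectorField n X)
    (h : ∀ x ∈ U, VectorField.mlieBracket 𝓘(ℂ, Fin n → ℂ) (fun y => V y) (fun y => W y) x = 0)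
    (x : X) : VectorField.mlieBracket 𝓘(ℂ, Fin n → ℂ) (fun y => V y) (fun y => W y) x = 0 := by
  obtain ⟨e, he, hx⟩ := exists_mem_holCharts (n := n) x
  set F : X → (Fin n → ℂ) := fun y =>
    VectorField.lieBracket ℂ (coordField e V) (coordField e W) (e y)
  have hF : ContinuousAt F x :=
    ((continuousOn_lieBracket_coordField he V W).continuousAt
      (e.open_target.mem_nhds (e.map_source hx))).comp (e.continuousAt hx)
  have hiff : ∀ y ∈ e.source, F y = 0 ↔
      VectorField.mlieBracket 𝓘(ℂ, Fin n → ℂ) (fun y => V y) (fun y => W y) y = 0 := by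
    intro y hy
    have := lieBracket_coordField_eq_zero_iff he V W (e.map_source hy)
    rwa [e.left_inv hy] at this
  rw [← hiff x hx]
  have hcl : x ∈ closure (e.source ∩ U) :=
    hU.open_subset_closure_inter e.open_source hx
  have hne : Filter.NeBot (nhdsWithin x (e.source ∩ U)) := mem_closure_iff_nhdsWithin_neBot.1 hcl
  -- The coordinate bracket is continuous at `x` and zero on a set accumulating at `x`, so its value
  -- there is the limit 0.
  refine tendsto_nhds_unique (l := nhdsWithin x (e.source ∩ U))
    (hF.tendsto.mono_left nhdsWithin_le_nhds) ?_
  refine tendsto_const_nhds.congr' ?_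
  filter_upwards [self_mem_nhdsWithin] with y hy
  exact ((hiff y hy.1).2 (h y hy.2)).symm

/-- Bilinearity of the bracket over the constants reduces commutativity of V to its generators. -/
theorem isAbelianSpace_span_iff (s : Fin n → HolVectorField n X) :
    IsAbelianSpace (Submodule.span ℂ (Set.range s)) ↔ ∀ j k x,
      VectorField.mlieBracket 𝓘(ℂ, Fin n → ℂ) (fun y => s j y) (fun y => s k y) x = 0 := by
  constructor
  · intro h j k x
    exact h _ (Submodule.subset_span ⟨j, rfl⟩) _ (Submodule.subset_span ⟨k, rfl⟩) x
  · intro h ζ hζ ξ hξ x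
    induction hζ using Submodule.span_induction with
    | mem V hV =>
      obtain ⟨j, rfl⟩ := hV
      induction hξ using Submodule.span_induction with
      | mem W hW => obtain ⟨k, rfl⟩ := hW; exact h j k x
      | zero => exact congrFun VectorField.mlieBracket_zero_right x
      | add V W _ _ hV hW =>
        have := VectorField.mlieBracket_add_right (V := fun y => s j y)
          (mdifferentiableAt_section V x) (mdifferentiableAt_section W x)
        rw [hV, hW, add_zero] at this
        exact this
      | smul c V _ hV =>
        have := VectorField.mlieBracket_const_smul_right (V := fun y => s j y) (c := c)
          (mdifferentiableAt_section V x)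
        rw [hV, smul_zero] at this
        exact this
    | zero => exact congrFun VectorField.mlieBracket_zero_left x
    | add V W _ _ hV hW =>
      have := VectorField.mlieBracket_add_left (W := fun y => ξ y)
        (mdifferentiableAt_section V x) (mdifferentiableAt_section W x)
      rw [hV, hW, add_zero] at this
      exact this
    | smul c V _ hV =>
      have := VectorField.mlieBracket_const_smul_left (W := fun y => ξ y) (c := c)
        (mdifferentiableAt_section V x)
      rw [hV, smul_zero] at this
      exact this

end Charts

/-! ### Smooth dependence of determinants and inverse matrices. -/

theorem contDiffOn_matrix_det {𝕜 E : Type*} [NontriviallyNormedField 𝕜] [NormedAddCommGroup E]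
    [NormedSpace 𝕜 E] {m : WithTop ℕ∞} {U : Set E} {n : ℕ} {A : E → Matrix (Fin n) (Fin n) 𝕜}
    (hA : ∀ i j, ContDiffOn 𝕜 m (fun z => A z i j) U) :
    ContDiffOn 𝕜 m (fun z => (A z).det) U := by
  simp only [Matrix.det_apply']
  exact ContDiffOn.sum fun σ _ => contDiffOn_const.mul (contDiffOn_prod fun i _ => hA _ _)

/-- Cramer's rule: the entries are determinants divided by the nonvanishing `(A z).det`. -/
theorem contDiffOn_matrix_inv {E : Type*} [NormedAddCommGroup E]
    [NormedSpace ℂ E] {m : WithTop ℕ∞} {U : Set E} {n : ℕ} {A : E → Matrix (Fin n) (Fin n) ℂ}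
    (hA : ∀ i j, ContDiffOn ℂ m (fun z => A z i j) U) (h0 : ∀ z ∈ U, (A z).det ≠ 0) (i j : Fin n) :
    ContDiffOn ℂ m (fun z => (A z)⁻¹ i j) U := by
  simp only [Matrix.inv_def, Ring.inverse_eq_inv', Matrix.smul_apply, smul_eq_mul,
    Matrix.adjugate_apply]
  refine ((contDiffOn_matrix_det hA).inv h0).mul (contDiffOn_matrix_det fun k l => ?_)
  simp only [Matrix.updateRow_apply]
  split_ifs
  · exact contDiffOn_const
  · exact hA k l

/-! ### Functions differing locally by holomorphic units. -/

section LocallyAssociated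

variable {n : ℕ} {X : Type*} [TopologicalSpace X] [ChartedSpace (Fin n → ℂ) X]
  {f g h : X → ℂ} {A B : Set X}

theorem LocallyAssociatedOn.mono (hfg : LocallyAssociatedOn n f g A) (hBA : B ⊆ A) :
    LocallyAssociatedOn n f g B := fun x hx =>
  let ⟨W, hW, hxW, u, hu, hu0, hfu⟩ := hfg x (hBA hx)
  ⟨W, hW, hxW, u, hu, hu0, fun y hy => hfu y ⟨hy.1, hBA hy.2⟩⟩

theorem LocallyAssociatedOn.symm (hfg : LocallyAssociatedOn n f g A) :
    LocallyAssociatedOn n g f A := fun x hx =>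
  let ⟨W, hW, hxW, u, hu, hu0, hfu⟩ := hfg x hx
  ⟨W, hW, hxW, fun y => (u y)⁻¹, ContMDiffOn.inv₀ hu hu0, fun y hy => inv_ne_zero (hu0 y hy),
    fun y hy => by rw [hfu y hy, inv_mul_cancel_left₀ (hu0 y hy.1)]⟩

theorem LocallyAssociatedOn.trans (hfg : LocallyAssociatedOn n f g A)
    (hgh : LocallyAssociatedOn n g h A) : LocallyAssociatedOn n f h A := fun x hx =>
  let ⟨W, hW, hxW, u, hu, hu0, hfu⟩ := hfg x hx
  let ⟨W', hW', hxW', v, hv, hv0, hgv⟩ := hgh x hx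
  ⟨W ∩ W', hW.inter hW', ⟨hxW, hxW'⟩, fun y => v y * u y,
    ContMDiffOn.mul (hv.mono Set.inter_subset_right) (hu.mono Set.inter_subset_left),
    fun y hy => mul_ne_zero (hv0 y hy.2) (hu0 y hy.1),
    fun y hy => by rw [hgv y ⟨hy.1.2, hy.2⟩, hfu y ⟨hy.1.1, hy.2⟩, mul_assoc]⟩

/-- Local association may be checked on an open cover. -/
theorem LocallyAssociatedOn.of_locally
    (hfg : ∀ x ∈ A, ∃ B : Set X, IsOpen B ∧ x ∈ B ∧ LocallyAssociatedOn n f g (A ∩ B)) :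
    LocallyAssociatedOn n f g A := fun x hx =>
  let ⟨B, hB, hxB, hloc⟩ := hfg x hx
  let ⟨W, hW, hxW, u, hu, hu0, hfu⟩ := hloc x ⟨hx, hxB⟩
  ⟨W ∩ B, hW.inter hB, ⟨hxW, hxB⟩, u, hu.mono Set.inter_subset_left, fun y hy => hu0 y hy.1,
    fun y hy => hfu y ⟨hy.1.1, hy.2, hy.1.2⟩⟩

theorem LocallyAssociatedOn.holomorphicOn (hfg : LocallyAssociatedOn n f g A) (hA : IsOpen A)
    (hf : HolomorphicOn n f A) : HolomorphicOn n g A := by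
  intro x hx
  obtain ⟨W, hW, hxW, u, hu, -, hfu⟩ := hfg x hx
  have h1 : ContMDiffOn 𝓘(ℂ, Fin n → ℂ) 𝓘(ℂ, ℂ) ω (fun y => u y * f y) (W ∩ A) :=
    ContMDiffOn.mul (hu.mono Set.inter_subset_left) (hf.mono Set.inter_subset_right)
  have h2 : ContMDiffOn 𝓘(ℂ, Fin n → ℂ) 𝓘(ℂ, ℂ) ω g (W ∩ A) := h1.congr hfu
  exact (h2.contMDiffAt ((hW.inter hA).mem_nhds ⟨hxW, hx⟩)).contMDiffWithinAt

theorem LocallyAssociatedOn.eq_zero_iff (hfg : LocallyAssociatedOn n f g A) {x : X} (hx : x ∈ A) :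
    g x = 0 ↔ f x = 0 := by
  obtain ⟨W, hW, hxW, u, hu, hu0, hfu⟩ := hfg x hx
  rw [hfu x ⟨hxW, hx⟩, mul_eq_zero, or_iff_right (hu0 x hxW)]

end LocallyAssociated

/-! ### The wedge product and its zero divisor. -/

section Coefficients

variable {n : ℕ} {X : Type*} [TopologicalSpace X] [ChartedSpace (Fin n → ℂ) X]
  [IsManifold 𝓘(ℂ, Fin n → ℂ) ω X] {e e' : OpenPartialHomeomorph X (Fin n → ℂ)}

omit [IsManifold 𝓘(ℂ, Fin n → ℂ) ω X] in
theorem holomorphicOn_comp_chart (he : e ∈ holCharts n X) {f : (Fin n → ℂ) → ℂ}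
    {V : Set (Fin n → ℂ)} (hf : ContDiffOn ℂ ω f V) {W : Set X} (hW : W ⊆ e.source)
    (hWV : ∀ x ∈ W, e x ∈ V) : HolomorphicOn n (fun x => f (e x)) W :=
  hf.contMDiffOn.comp ((contMDiffOn_of_mem_maximalAtlas he).mono hW) hWV

/-- The matrix whose rows are the fields `s i` in the chart `e`. -/
def frameMatrix (e : OpenPartialHomeomorph X (Fin n → ℂ)) (s : Fin n → HolVectorField n X)
    (z : Fin n → ℂ) : Matrix (Fin n) (Fin n) ℂ :=
  Matrix.of fun i => coordField e (s i) z

theorem contDiffOn_frameMatrix (he : e ∈ holCharts n X) (s : Fin n → HolVectorField n X)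
    (i j : Fin n) : ContDiffOn ℂ ω (fun z => frameMatrix e s z i j) e.target :=
  contDiffOn_pi.1 (contDiffOn_coordField he (s i)) j

theorem coeff_wedge_symm (he : e ∈ holCharts n X) (s : Fin n → HolVectorField n X)
    {z : Fin n → ℂ} (hz : z ∈ e.target) :
    (wedge s).coeff e (e.symm z) = (frameMatrix e s z).det := by
  rw [MultivectorField.coeff, wedge, exteriorPower.alternatingMapLinearEquiv_apply_ιMulti]
  have : frameMatrix e s z = fun i => mfderiv 𝓘(ℂ, Fin n → ℂ) 𝓘(ℂ, Fin n → ℂ) e (e.symm z)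
      (s i (e.symm z)) := funext fun i => coordField_eq_mfderiv he (s i) hz
  rw [this]
  exact Pi.basisFun_det_apply _

theorem coeff_wedge (he : e ∈ holCharts n X) (s : Fin n → HolVectorField n X)
    {x : X} (hx : x ∈ e.source) :
    (wedge s).coeff e x = (frameMatrix e s (e x)).det := by
  have := coeff_wedge_symm he s (e.map_source hx)
  rwa [e.left_inv hx] at this

theorem wedge_isHolomorphic (s : Fin n → HolVectorField n X) : (wedge s).IsHolomorphic := by
  intro e he
  exact (holomorphicOn_comp_chart he (contDiffOn_matrix_det (contDiffOn_frameMatrix he s))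
    subset_rfl fun x hx => e.map_source hx).congr fun x hx => coeff_wedge he s hx

omit [IsManifold 𝓘(ℂ, Fin n → ℂ) ω X] in
theorem contDiffOn_transition (he : e ∈ holCharts n X) (he' : e' ∈ holCharts n X) :
    ContDiffOn ℂ ω (e' ∘ e.symm) (e.target ∩ e.symm ⁻¹' e'.source) :=
  ((contMDiffOn_of_mem_maximalAtlas he').comp
    ((contMDiffOn_symm_of_mem_maximalAtlas he).mono Set.inter_subset_left)
    fun _ hz => hz.2).contDiffOn

/-- The determinant of the Jacobian matrix of the change of coordinates from `e` to `e'`. -/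
def jacobian (e e' : OpenPartialHomeomorph X (Fin n → ℂ)) (z : Fin n → ℂ) : ℂ :=
  (LinearMap.toMatrix' (fderiv ℂ (e' ∘ e.symm) z : (Fin n → ℂ) →ₗ[ℂ] (Fin n → ℂ))).det

omit [IsManifold 𝓘(ℂ, Fin n → ℂ) ω X] in
theorem contDiffOn_jacobian (he : e ∈ holCharts n X) (he' : e' ∈ holCharts n X) :
    ContDiffOn ℂ ω (jacobian e e') (e.target ∩ e.symm ⁻¹' e'.source) := by
  refine contDiffOn_matrix_det fun i j => ?_
  simp only [LinearMap.toMatrix'_apply]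
  have h := (contDiffOn_transition he he').fderiv_of_isOpen (m := ω)
    (e.isOpen_inter_preimage_symm e'.open_source) le_rfl
  exact contDiffOn_pi.1 (h.clm_apply contDiffOn_const) i

omit [IsManifold 𝓘(ℂ, Fin n → ℂ) ω X] in
theorem fderiv_transition_apply (he : e ∈ holCharts n X) (he' : e' ∈ holCharts n X)
    {z : Fin n → ℂ} (hz : z ∈ e.target) (hz' : e.symm z ∈ e'.source) (v : Fin n → ℂ) :
    fderiv ℂ (e' ∘ e.symm) z v = mfderiv 𝓘(ℂ, Fin n → ℂ) 𝓘(ℂ, Fin n → ℂ) e' (e.symm z)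
      (mfderiv 𝓘(ℂ, Fin n → ℂ) 𝓘(ℂ, Fin n → ℂ) e.symm z v) := by
  rw [← mfderiv_eq_fderiv]
  exact congrArg (fun L => L v) (mfderiv_comp z
    ((mdifferentiable_of_mem_holCharts he').mdifferentiableAt hz')
    ((mdifferentiable_of_mem_holCharts he).mdifferentiableAt_symm hz))

omit [IsManifold 𝓘(ℂ, Fin n → ℂ) ω X] in
theorem jacobian_ne_zero (he : e ∈ holCharts n X) (he' : e' ∈ holCharts n X)
    {z : Fin n → ℂ} (hz : z ∈ e.target) (hz' : e.symm z ∈ e'.source) : jacobian e e' z ≠ 0 := by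
  rw [jacobian, LinearMap.det_toMatrix']
  intro h
  -- A kernel vector is killed by a composition of two injective chart differentials.
  refine (LinearMap.bot_lt_ker_of_det_eq_zero h).ne' (LinearMap.ker_eq_bot'.2 fun v hv => ?_)
  have hv : fderiv ℂ (e' ∘ e.symm) z v = 0 := hv
  rw [fderiv_transition_apply he he' hz hz'] at hv
  have h1 := (mdifferentiable_of_mem_holCharts he').mfderiv_injective hz' (hv.trans (map_zero _).symm)
  exact (mdifferentiable_of_mem_holCharts he).symm.mfderiv_injective hz (h1.trans (map_zero _).symm)

theorem frameMatrix_transition (he : e ∈ holCharts n X) (he' : e' ∈ holCharts n X)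
    (s : Fin n → HolVectorField n X) {x : X} (hx : x ∈ e.source) (hx' : x ∈ e'.source) :
    (frameMatrix e' s (e' x)).det = jacobian e e' (e x) * (frameMatrix e s (e x)).det := by
  have hz := e.map_source hx
  have hzx := e.left_inv hx
  -- The fields are rows, so the Jacobian matrix acts through its transpose on the right.
  rw [jacobian, mul_comm, ← Matrix.det_transpose (LinearMap.toMatrix' _), ← Matrix.det_mul]
  congr 1
  ext i k
  have h1 : coordField e' (s i) (e' x) = fderiv ℂ (e' ∘ e.symm) (e x) (coordField e (s i) (e x)) := by
    rw [fderiv_transition_apply he he' hz (by rwa [hzx])]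
    erw [mfderiv_symm_coordField he (s i) hz]
    rw [coordField_eq_mfderiv he' (s i) (e'.map_source hx'), e'.left_inv hx', hzx]
  have h2 := congrFun (LinearMap.toMatrix'_mulVec
    (fderiv ℂ (e' ∘ e.symm) (e x) : (Fin n → ℂ) →ₗ[ℂ] (Fin n → ℂ)) (coordField e (s i) (e x))) k
  rw [frameMatrix, Matrix.of_apply, h1]
  rw [ContinuousLinearMap.coe_coe] at h2
  rw [← h2, Matrix.mul_apply, Matrix.mulVec, dotProduct]
  exact Finset.sum_congr rfl fun j _ => mul_comm _ _

theorem coeff_wedge_locallyAssociatedOn (he : e ∈ holCharts n X) (he' : e' ∈ holCharts n X)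
    (s : Fin n → HolVectorField n X) :
    LocallyAssociatedOn n ((wedge s).coeff e) ((wedge s).coeff e') (e.source ∩ e'.source) := by
  intro x hx
  refine ⟨e.source ∩ e'.source, e.open_source.inter e'.open_source, hx,
    fun y => jacobian e e' (e y), ?_, ?_, ?_⟩
  · refine holomorphicOn_comp_chart he (contDiffOn_jacobian he he') Set.inter_subset_left ?_
    exact fun y hy => ⟨e.map_source hy.1, by rw [Set.mem_preimage, e.left_inv hy.1]; exact hy.2⟩
  · exact fun y hy => jacobian_ne_zero he he' (e.map_source hy.1) (by rw [e.left_inv hy.1]; exact hy.2)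
  · rintro y ⟨hy, -⟩
    rw [coeff_wedge he' s hy.2, coeff_wedge he s hy.1, frameMatrix_transition he he' s hy.1 hy.2]

theorem generateAt_iff_linearIndependent (s : Fin n → HolVectorField n X) (x : X) :
    GenerateAt s x ↔ LinearIndependent ℂ (fun i => s i x) := by
  have hd : Module.finrank ℂ (TangentSpace 𝓘(ℂ, Fin n → ℂ) x) = n :=
    Module.finrank_fin_fun ℂ
  have : FiniteDimensional ℂ (TangentSpace 𝓘(ℂ, Fin n → ℂ) x) :=
    inferInstanceAs (FiniteDimensional ℂ (Fin n → ℂ))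
  constructor
  · intro h
    exact linearIndependent_of_top_le_span_of_card_eq_finrank (le_of_eq h.symm) (by simp [hd])
  · intro h
    exact h.span_eq_top_of_card_eq_finrank' (by simp [hd])

/-- The differential of the chart is injective, so independence of the fields is independence of the
rows of `frameMatrix`. -/
theorem generateAt_symm_iff (he : e ∈ holCharts n X) (s : Fin n → HolVectorField n X)
    {z : Fin n → ℂ} (hz : z ∈ e.target) :
    GenerateAt s (e.symm z) ↔ (frameMatrix e s z).det ≠ 0 := by
  rw [generateAt_iff_linearIndependent, ← isUnit_iff_ne_zero, ← Matrix.isUnit_iff_isUnit_det,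
    ← Matrix.linearIndependent_rows_iff_isUnit]
  have h : (frameMatrix e s z).row = (mfderiv 𝓘(ℂ, Fin n → ℂ) 𝓘(ℂ, Fin n → ℂ) e
      (e.symm z)).toLinearMap ∘ fun i => s i (e.symm z) :=
    funext fun i => coordField_eq_mfderiv he (s i) hz
  rw [h]
  exact ((LinearMap.linearIndependent_iff _ (LinearMap.ker_eq_bot.2
    ((mdifferentiable_of_mem_holCharts he).mfderiv_injective (e.map_target hz)))).symm)

theorem generateAt_iff_coeff_ne_zero (he : e ∈ holCharts n X) (s : Fin n → HolVectorField n X)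
    {x : X} (hx : x ∈ e.source) : GenerateAt s x ↔ (wedge s).coeff e x ≠ 0 := by
  have := generateAt_symm_iff he s (e.map_source hx)
  rwa [e.left_inv hx, ← coeff_wedge he s hx] at this

theorem wedge_eq_zero_iff (s : Fin n → HolVectorField n X) (x : X) :
    wedge s x = 0 ↔ ¬ GenerateAt s x := by
  constructor
  · intro h hg
    obtain ⟨e, he, hx⟩ := exists_mem_holCharts (n := n) x
    exact (generateAt_iff_coeff_ne_zero he s hx).1 hg (by rw [MultivectorField.coeff, h, map_zero])
  · intro h
    rw [generateAt_iff_linearIndependent] at h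
    exact AlternatingMap.map_linearDependent _ _ h

theorem isOpen_generateAt (s : Fin n → HolVectorField n X) : IsOpen {x | GenerateAt s x} := by
  rw [isOpen_iff_mem_nhds]
  intro x hx
  obtain ⟨e, he, hxe⟩ := exists_mem_holCharts (n := n) x
  have hc := ((wedge_isHolomorphic s e he).contMDiffAt (e.open_source.mem_nhds hxe)).continuousAt
  filter_upwards [e.open_source.mem_nhds hxe,
    hc.eventually_ne ((generateAt_iff_coeff_ne_zero he s hxe).1 hx)] with y hy hy0
  exact (generateAt_iff_coeff_ne_zero he s hy).2 hy0

/-- Evaluation of holomorphic vector fields at a point. -/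
def evalField (x : X) : HolVectorField n X →ₗ[ℂ] TangentSpace 𝓘(ℂ, Fin n → ℂ) x where
  toFun V := V x
  map_add' _ _ := rfl
  map_smul' _ _ := rfl

/-- Writing each `t i` as a constant combination of the `s j` factors the frame matrix; the constant
is the determinant of the coefficients, possibly zero here. -/
theorem coeff_wedge_span {s t : Fin n → HolVectorField n X}
    (hst : Submodule.span ℂ (Set.range t) ≤ Submodule.span ℂ (Set.range s)) :
    ∃ c : ℂ, ∀ e ∈ holCharts n X, ∀ x ∈ e.source,
      (wedge t).coeff e x = c * (wedge s).coeff e x := by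
  have h : ∀ i, ∃ c : Fin n → ℂ, ∑ j, c j • s j = t i := fun i =>
    (Submodule.mem_span_range_iff_exists_fun ℂ).1 (hst (Submodule.subset_span ⟨i, rfl⟩))
  choose c hc using h
  refine ⟨(Matrix.of c).det, fun e he x hx => ?_⟩
  rw [coeff_wedge he t hx, coeff_wedge he s hx, ← Matrix.det_mul]
  congr 1
  ext i k
  have h : coordField e (t i) (e x) = ∑ j, c i j • coordField e (s j) (e x) := by
    simp only [coordField_eq_mfderiv he _ (e.map_source hx)]
    have h := congrArg (mfderiv 𝓘(ℂ, Fin n → ℂ) 𝓘(ℂ, Fin n → ℂ) e (e.symm (e x)))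
      (congrArg (evalField (e.symm (e x))) (hc i))
    simp only [map_sum, map_smul] at h
    exact h.symm
  simp [frameMatrix, h, Matrix.mul_apply]

theorem GenerateAt.of_span_le {s t : Fin n → HolVectorField n X}
    (hst : Submodule.span ℂ (Set.range s) ≤ Submodule.span ℂ (Set.range t)) {x : X}
    (hx : GenerateAt s x) : GenerateAt t x := by
  have h : ∀ r : Fin n → HolVectorField n X, Submodule.span ℂ (Set.range fun i => r i x) =
      (Submodule.span ℂ (Set.range r)).map (evalField x) := fun r => by
    rw [Submodule.map_span, ← Set.range_comp]
    rfl
  rw [GenerateAt, h] at hx ⊢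
  exact top_le_iff.1 (hx.ge.trans (Submodule.map_mono hst))

/-- The zero divisor of `s⁽¹⁾ ∧ … ∧ s⁽ⁿ⁾`. -/
def wedgeDivisor (s : Fin n → HolVectorField n X) (hs : GenerateAtGeneralPoint s) :
    EffectiveDivisor n X where
  -- Admitting every function associated to the chart coefficients builds maximality into the
  -- definition.
  IsLocalEq U f := ∀ e ∈ holCharts n X,
    LocallyAssociatedOn n ((wedge s).coeff e) f ((U : Set X) ∩ e.source)
  holomorphicOn U f hf x hx := by
    obtain ⟨e, he, hxe⟩ := exists_mem_holCharts (n := n) x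
    have hO := U.isOpen.inter e.open_source
    exact (((hf e he).holomorphicOn hO ((wedge_isHolomorphic s e he).mono
      Set.inter_subset_right)).contMDiffAt (hO.mem_nhds ⟨hx, hxe⟩)).contMDiffWithinAt
  nontrivial U f hf W hW hne hWU := by
    obtain ⟨G, -, hG, hGs⟩ := hs
    obtain ⟨x, hxW, hxG⟩ := hG.inter_open_nonempty W hW hne
    obtain ⟨e, he, hxe⟩ := exists_mem_holCharts (n := n) x
    exact ⟨x, hxW, fun h => (generateAt_iff_coeff_ne_zero he s hxe).1 (hGs x hxG)
      (((hf e he).eq_zero_iff ⟨hWU hxW, hxe⟩).1 h)⟩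
  cover x := by
    obtain ⟨e, he, hxe⟩ := exists_mem_holCharts (n := n) x
    exact ⟨⟨e.source, e.open_source⟩, (wedge s).coeff e, hxe, fun e' he' =>
      (coeff_wedge_locallyAssociatedOn he' he s).mono fun y hy => ⟨hy.2, hy.1⟩⟩
  compatible U f V g hf hg := LocallyAssociatedOn.of_locally fun x hx => by
    obtain ⟨e, he, hxe⟩ := exists_mem_holCharts (n := n) x
    exact ⟨e.source, e.open_source, hxe,
      ((hf e he).mono fun y hy => ⟨hy.1.1, hy.2⟩).symm.trans
        ((hg e he).mono fun y hy => ⟨hy.1.2, hy.2⟩)⟩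
  -- The coefficient in `e` is itself a local equation on the chart domain, so it serves as the test
  -- equation.
  maximal U f h e he := h ⟨e.source, e.open_source⟩ _ fun e' he' =>
    (coeff_wedge_locallyAssociatedOn he' he s).mono fun y hy => ⟨hy.2, hy.1⟩

theorem wedgeDivisor_isZeroDivisorOf {s : Fin n → HolVectorField n X}
    (hs : GenerateAtGeneralPoint s) {t : Fin n → HolVectorField n X}
    (hts : Submodule.span ℂ (Set.range t) = Submodule.span ℂ (Set.range s)) :
    (wedgeDivisor s hs).IsZeroDivisorOf (wedge t) := by
  intro e he e' he' x hx
  obtain ⟨c, hc⟩ := coeff_wedge_span hts.le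
  obtain ⟨G, -, hG, hGs⟩ := hs
  obtain ⟨y, hye, hyG⟩ := hG.inter_open_nonempty e.source e.open_source ⟨x, hx.1⟩
  -- At the point `y` the family `s` generates, hence so does `t`, having the same span; its
  -- coefficient there cannot vanish.
  have hc0 : c ≠ 0 := by
    rintro rfl
    have := (generateAt_iff_coeff_ne_zero he t hye).1 ((hGs y hyG).of_span_le hts.ge)
    rw [hc e he y hye, zero_mul] at this
    exact this rfl
  have h1 : LocallyAssociatedOn n ((wedge s).coeff e) ((wedge t).coeff e)
      (e.source ∩ e'.source) := fun y _ =>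
    ⟨Set.univ, isOpen_univ, trivial, fun _ => c, contMDiffOn_const, fun _ _ => hc0,
      fun z hz => hc e he z hz.2.1⟩
  exact (((coeff_wedge_locallyAssociatedOn he' he s).mono fun y hy => ⟨hy.2, hy.1⟩).trans h1) x hx

theorem wedgeDivisor_support (s : Fin n → HolVectorField n X) (hs : GenerateAtGeneralPoint s) :
    (wedgeDivisor s hs).support = {x | wedge s x = 0} := by
  ext x
  obtain ⟨e, he, hxe⟩ := exists_mem_holCharts (n := n) x
  rw [Set.mem_ofPred_eq, wedge_eq_zero_iff, generateAt_iff_coeff_ne_zero he s hxe, not_not]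
  constructor
  · rintro ⟨U, f, hxU, hf, hfx⟩
    exact ((hf e he).eq_zero_iff ⟨hxU, hxe⟩).1 hfx
  · intro h
    exact ⟨_, _, hxe, wedgeDivisor_isZeroDivisorOf hs rfl e he, h⟩

end Coefficients

/-! ### The frame metric: smoothness, Ricci form and Kähler condition. -/

theorem form11_apply {n : ℕ} (A : Matrix (Fin n) (Fin n) ℂ) (v : Fin 2 → Fin n → ℂ) :
    form11 A v = ∑ j, ∑ k, A j k *
      (v 0 j * starRingEnd ℂ (v 1 k) - v 1 j * starRingEnd ℂ (v 0 k)) := rfl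

section Metric

variable {n : ℕ} {X : Type*} [TopologicalSpace X] [ChartedSpace (Fin n → ℂ) X]
  [IsManifold 𝓘(ℂ, Fin n → ℂ) ω X] {e : OpenPartialHomeomorph X (Fin n → ℂ)}

theorem dualFrame_apply {s : Fin n → HolVectorField n X} {x : X} (hx : GenerateAt s x)
    (i j : Fin n) : dualFrame s x i (s j x) = if i = j then 1 else 0 := by
  have h : LinearIndependent ℂ (fun i => s i x) ∧
      ⊤ ≤ Submodule.span ℂ (Set.range fun i => s i x) :=
    ⟨(generateAt_iff_linearIndependent s x).1 hx, hx.ge⟩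
  have hj : s j x = Module.Basis.mk h.1 h.2 j := by simp
  rw [dualFrame, dif_pos h, hj, Module.Basis.coord_apply, Module.Basis.repr_self,
    Finsupp.single_apply]
  simp [eq_comm]

theorem eq_zero_of_dualFrame {s : Fin n → HolVectorField n X} {x : X} (hx : GenerateAt s x)
    {u : TangentSpace 𝓘(ℂ, Fin n → ℂ) x} (hu : ∀ i, dualFrame s x i u = 0) : u = 0 := by
  have h : u ∈ Submodule.span ℂ (Set.range fun i => s i x) := hx ▸ Submodule.mem_top
  obtain ⟨c, rfl⟩ := (Submodule.mem_span_range_iff_exists_fun ℂ).1 h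
  have hc : ∀ i, c i = 0 := fun i => by
    simpa [map_sum, dualFrame_apply hx] using hu i
  simp [hc]

/-- The coordinates of the points where the `s i` generate the tangent space. -/
theorem mem_coordDomain_iff (he : e ∈ holCharts n X) (s : Fin n → HolVectorField n X)
    {z : Fin n → ℂ} : z ∈ coordDomain e {x | GenerateAt s x} ↔
      z ∈ e.target ∧ (frameMatrix e s z).det ≠ 0 :=
  and_congr_right fun hz => generateAt_symm_iff he s hz

theorem isOpen_coordDomain (e : OpenPartialHomeomorph X (Fin n → ℂ))
    (s : Fin n → HolVectorField n X) : IsOpen (coordDomain e {x | GenerateAt s x}) :=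
  e.isOpen_inter_preimage_symm (isOpen_generateAt s)

theorem vecMul_frameMatrix (s : Fin n → HolVectorField n X) (z v : Fin n → ℂ) :
    Matrix.vecMul v (frameMatrix e s z) = ∑ i, v i • coordField e (s i) z := by
  rw [Matrix.vecMul_eq_sum]
  rfl

/-- The row vector v M⁻¹ lists the coordinates of v in the frame, since (v M⁻¹) M = v. -/
theorem vecMul_inv_frameMatrix (he : e ∈ holCharts n X) (s : Fin n → HolVectorField n X)
    {z : Fin n → ℂ} (hz : z ∈ coordDomain e {x | GenerateAt s x}) (v : Fin n → ℂ) :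
    v = ∑ i, Matrix.vecMul v (frameMatrix e s z)⁻¹ i • coordField e (s i) z := by
  rw [← vecMul_frameMatrix, Matrix.vecMul_vecMul, Matrix.nonsing_inv_mul _
    (isUnit_iff_ne_zero.2 ((mem_coordDomain_iff he s).1 hz).2), Matrix.vecMul_one]

theorem dualFrame_mfderiv_symm (he : e ∈ holCharts n X) (s : Fin n → HolVectorField n X)
    {z : Fin n → ℂ} (hz : z ∈ coordDomain e {x | GenerateAt s x}) (v : Fin n → ℂ) (i : Fin n) :
    dualFrame s (e.symm z) i (mfderiv 𝓘(ℂ, Fin n → ℂ) 𝓘(ℂ, Fin n → ℂ) e.symm z v) =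
      Matrix.vecMul v (frameMatrix e s z)⁻¹ i := by
  have h : mfderiv 𝓘(ℂ, Fin n → ℂ) 𝓘(ℂ, Fin n → ℂ) e.symm z v =
      ∑ i, Matrix.vecMul v (frameMatrix e s z)⁻¹ i • s i (e.symm z) := by
    simp only [← mfderiv_symm_coordField he _ hz.1]
    have hL : ∀ L : (Fin n → ℂ) →L[ℂ] TangentSpace 𝓘(ℂ, Fin n → ℂ) (e.symm z), L v =
        ∑ i, Matrix.vecMul v (frameMatrix e s z)⁻¹ i • L (coordField e (s i) z) := fun L => by
      conv_lhs => rw [vecMul_inv_frameMatrix he s hz v]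
      rw [map_sum]
      simp only [map_smul]
    exact hL _
  rw [h, map_sum]
  simp [dualFrame_apply hz.2]

/-- The dual frame evaluated on the coordinate vectors gives the entries of M⁻¹, so the defining sum
is a matrix product. -/
theorem matrix_frameMetric (he : e ∈ holCharts n X) (s : Fin n → HolVectorField n X)
    {z : Fin n → ℂ} (hz : z ∈ coordDomain e {x | GenerateAt s x}) :
    (frameMetric s).matrix e z =
      (frameMatrix e s z)⁻¹ * ((frameMatrix e s z)⁻¹).conjTranspose := by
  ext j k
  simp only [PairingField.matrix, frameMetric, coordVector, Matrix.mul_apply,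
    Matrix.conjTranspose_apply]
  refine Finset.sum_congr rfl fun i _ => ?_
  rw [dualFrame_mfderiv_symm he s hz, dualFrame_mfderiv_symm he s hz]
  simp

theorem contDiffOn_inv_frameMatrix (he : e ∈ holCharts n X) (s : Fin n → HolVectorField n X)
    (i j : Fin n) : ContDiffOn ℂ ω (fun z => (frameMatrix e s z)⁻¹ i j)
      (coordDomain e {x | GenerateAt s x}) :=
  contDiffOn_matrix_inv (fun i j => (contDiffOn_frameMatrix he s i j).mono Set.inter_subset_left)
    (fun _ hz => ((mem_coordDomain_iff he s).1 hz).2) i j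

theorem contDiffOn_mul_conjTranspose (he : e ∈ holCharts n X) (s : Fin n → HolVectorField n X)
    (j k : Fin n) : ContDiffOn ℝ ∞ (fun z =>
      ((frameMatrix e s z)⁻¹ * ((frameMatrix e s z)⁻¹).conjTranspose) j k)
      (coordDomain e {x | GenerateAt s x}) := by
  have h : ∀ i j, ContDiffOn ℝ ∞ (fun z => (frameMatrix e s z)⁻¹ i j)
      (coordDomain e {x | GenerateAt s x}) := fun i j =>
    ((contDiffOn_inv_frameMatrix he s i j).restrict_scalars ℝ).of_le le_top
  simp only [Matrix.mul_apply, Matrix.conjTranspose_apply]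
  exact ContDiffOn.sum fun i _ => (h j i).mul
    ((Complex.conjCLE : ℂ →L[ℝ] ℂ).contDiff.comp_contDiffOn (h k i))

theorem frameMetric_isHermitianMetricOn (s : Fin n → HolVectorField n X) :
    (frameMetric s).IsHermitianMetricOn {x | GenerateAt s x} where
  isOpen := isOpen_generateAt s
  add_left x _ u u' v := by
    simp only [frameMetric, map_add, add_mul, Finset.sum_add_distrib]
  smul_left x _ c u v := by
    simp only [frameMetric, map_smul, smul_eq_mul, mul_assoc, Finset.mul_sum]
  conj_symm x _ u v := by
    simp only [frameMetric, map_sum, map_mul, Complex.conj_conj, mul_comm]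
  pos x hx u hu := by
    simp only [frameMetric, Complex.mul_conj, ← Complex.ofReal_sum, Complex.ofReal_re]
    refine lt_of_le_of_ne (Finset.sum_nonneg fun i _ => Complex.normSq_nonneg _) fun h => hu ?_
    refine eq_zero_of_dualFrame hx fun i => Complex.normSq_eq_zero.1 ?_
    exact (Finset.sum_eq_zero_iff_of_nonneg fun i _ => Complex.normSq_nonneg _).1 h.symm i
      (Finset.mem_univ i)
  smooth e he j k := (contDiffOn_mul_conjTranspose he s j k).congr fun z hz => by
    rw [matrix_frameMetric he s hz]

theorem frameMetric_isRicciFlatOn (s : Fin n → HolVectorField n X) :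
    (frameMetric s).IsRicciFlatOn {x | GenerateAt s x} := by
  intro e he z hz
  have hU := isOpen_coordDomain e s
  -- det (M⁻¹ (M⁻¹)*) = |det M⁻¹|².
  have hlog : ∀ y ∈ coordDomain e {x | GenerateAt s x}, (frameMetric s).logDet e y =
      ((Real.log (Complex.normSq (frameMatrix e s y)⁻¹.det) : ℝ) : ℂ) := by
    intro y hy
    rw [PairingField.logDet, matrix_frameMetric he s hy, Matrix.det_mul,
      Matrix.det_conjTranspose, ← starRingEnd_apply, Complex.mul_conj, Complex.ofReal_re]
  have hzero : ∀ j k, wirtinger j (wirtingerBar k ((frameMetric s).logDet e)) z = 0 := by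
    intro j k
    rw [← wirtinger_wirtingerBar_log_normSq hU
      (contDiffOn_matrix_det (contDiffOn_inv_frameMatrix he s)) (fun y hy => by
        rw [Matrix.det_nonsing_inv, Ring.inverse_eq_inv']
        exact inv_ne_zero ((mem_coordDomain_iff he s).1 hy).2) hz j k]
    -- The formula for log det holds only on the open coordinate domain, so it is transported
    -- through germs, once for each derivative.
    refine wirtinger_congr j ?_
    filter_upwards [hU.mem_nhds hz] with y hy
    refine wirtingerBar_congr k ?_
    filter_upwards [hU.mem_nhds hy] with w hw using hlog w hw
  ext v
  simp [PairingField.ricciForm, form11_apply, hzero]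

/-- `form11` as a linear map. -/
def form11Linear (n : ℕ) :
    (Fin n → Fin n → ℂ) →ₗ[ℝ] (Fin n → ℂ) [⋀^Fin 2]→L[ℝ] ℂ where
  toFun A := form11 (Matrix.of A)
  map_add' A B := by
    ext v
    simp [form11_apply, add_mul, Finset.sum_add_distrib]
  map_smul' c A := by
    ext v
    simp [form11_apply, mul_assoc, Finset.mul_sum]

theorem differentiableAt_form11 {A : (Fin n → ℂ) → Matrix (Fin n) (Fin n) ℂ} {z : Fin n → ℂ}
    (hA : ∀ j k, DifferentiableAt ℝ (fun y => A y j k) z) :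
    DifferentiableAt ℝ (fun y => form11 (A y)) z := by
  have h : DifferentiableAt ℝ (fun y => (fun j k => A y j k : Fin n → Fin n → ℂ)) z :=
    differentiableAt_pi.2 fun j => differentiableAt_pi.2 fun k => hA j k
  exact (LinearMap.toContinuousLinearMap (form11Linear n)).differentiableAt.comp z h

/-- The dual coframe of the `s i` in the chart `e`. -/
def coframe (e : OpenPartialHomeomorph X (Fin n → ℂ)) (s : Fin n → HolVectorField n X)
    (i : Fin n) (z : Fin n → ℂ) : (Fin n → ℂ) →L[ℂ] ℂ :=
  ∑ j, (frameMatrix e s z)⁻¹ j i • ContinuousLinearMap.proj j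

theorem coframe_apply (s : Fin n → HolVectorField n X) (i : Fin n) (z v : Fin n → ℂ) :
    coframe e s i z v = Matrix.vecMul v (frameMatrix e s z)⁻¹ i := by
  simp [coframe, Matrix.vecMul, dotProduct, mul_comm]

theorem coframe_coordField (he : e ∈ holCharts n X) (s : Fin n → HolVectorField n X)
    {z : Fin n → ℂ} (hz : z ∈ coordDomain e {x | GenerateAt s x}) (i j : Fin n) :
    coframe e s i z (coordField e (s j) z) = if i = j then 1 else 0 := by
  rw [coframe_apply]
  have h := congrFun (congrFun (Matrix.mul_nonsing_inv (frameMatrix e s z)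
    (isUnit_iff_ne_zero.2 ((mem_coordDomain_iff he s).1 hz).2)) j) i
  rw [Matrix.one_apply] at h
  simp only [eq_comm (a := i)]
  rw [← h]
  rfl

theorem differentiableAt_coframe (he : e ∈ holCharts n X) (s : Fin n → HolVectorField n X)
    {z : Fin n → ℂ} (hz : z ∈ coordDomain e {x | GenerateAt s x}) (i : Fin n) :
    DifferentiableAt ℂ (coframe e s i) z := by
  refine DifferentiableAt.fun_sum fun j _ => DifferentiableAt.smul_const ?_ _
  exact ((contDiffOn_inv_frameMatrix he s j i).contDiffAt
    ((isOpen_coordDomain e s).mem_nhds hz)).differentiableAt (by simp)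

/-- Rewrites the form of M⁻¹(M⁻¹)* as c ∑ θⁱ ∧ conj θⁱ, the shape to which the coframe criterion
applies. -/
theorem form11_mul_conjTranspose (s : Fin n → HolVectorField n X) (c : ℂ) (z : Fin n → ℂ)
    (v : Fin 2 → Fin n → ℂ) :
    form11 (c • ((frameMatrix e s z)⁻¹ * ((frameMatrix e s z)⁻¹).conjTranspose)) v =
      c * ∑ i, (coframe e s i z (v 0) * starRingEnd ℂ (coframe e s i z (v 1)) -
        coframe e s i z (v 1) * starRingEnd ℂ (coframe e s i z (v 0))) := by
  have h : ∀ i, coframe e s i z (v 0) * starRingEnd ℂ (coframe e s i z (v 1)) -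
      coframe e s i z (v 1) * starRingEnd ℂ (coframe e s i z (v 0)) =
      ∑ j, ∑ k, (frameMatrix e s z)⁻¹ j i * starRingEnd ℂ ((frameMatrix e s z)⁻¹ k i) *
        (v 0 j * starRingEnd ℂ (v 1 k) - v 1 j * starRingEnd ℂ (v 0 k)) := fun i => by
    simp only [coframe_apply, Matrix.vecMul, dotProduct, map_sum, map_mul, Finset.sum_mul_sum,
      ← Finset.sum_sub_distrib]
    exact Finset.sum_congr rfl fun j _ => Finset.sum_congr rfl fun k _ => by ring
  simp only [h, form11_apply, Matrix.smul_apply, smul_eq_mul, Matrix.mul_apply,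
    Matrix.conjTranspose_apply, Complex.star_def, Finset.mul_sum, Finset.sum_mul]
  rw [Finset.sum_comm (s := Finset.univ (α := Fin n)) (f := fun i j => ∑ k, c * _)]
  refine Finset.sum_congr rfl fun j _ => ?_
  rw [Finset.sum_comm]
  exact Finset.sum_congr rfl fun i _ => Finset.sum_congr rfl fun k _ => by ring

theorem extDeriv_fundamentalForm_eq_zero_iff (he : e ∈ holCharts n X)
    (s : Fin n → HolVectorField n X) {z : Fin n → ℂ}
    (hz : z ∈ coordDomain e {x | GenerateAt s x}) :
    extDeriv ((frameMetric s).fundamentalForm e) z = 0 ↔ ∀ j k,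
      VectorField.mlieBracket 𝓘(ℂ, Fin n → ℂ) (fun y => s j y) (fun y => s k y) (e.symm z) = 0 := by
  have hU := (isOpen_coordDomain e s).mem_nhds hz
  have hcongr : (frameMetric s).fundamentalForm e =ᶠ[𝓝 z] fun y => form11 ((Complex.I / 2) •
      ((frameMatrix e s y)⁻¹ * ((frameMatrix e s y)⁻¹).conjTranspose)) := by
    filter_upwards [hU] with y hy
    rw [PairingField.fundamentalForm, matrix_frameMetric he s hy]
  have hθ := differentiableAt_coframe he s hz
  rw [extDeriv, hcongr.fderiv_eq, ← extDeriv,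
    extDeriv_sum_wedge_conj_eq_zero_iff hθ (differentiableAt_form11 fun j k => ?_)
      (c := Complex.I / 2) (by simp) (fun y v => form11_mul_conjTranspose s _ y v)
      (coframe_coordField he s hz),
    extDerivOne_eq_zero_iff (a := fun i => coordField e (s i)) hθ
      (fun i => ((contDiffOn_coordField he (s i)).contDiffAt
        (e.open_target.mem_nhds hz.1)).differentiableAt (by simp))
      (by filter_upwards [hU] with y hy using coframe_coordField he s hy)
      (fun v => by simpa only [coframe_apply] using vecMul_inv_frameMatrix he s hz v)]
  · exact forall₂_congr fun j k => lieBracket_coordField_eq_zero_iff he (s j) (s k) hz.1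
  · exact (((contDiffOn_mul_conjTranspose he s j k).contDiffAt hU).differentiableAt
      (by simp)).const_smul (Complex.I / 2)

theorem frameMetric_isKahlerOn_iff (s : Fin n → HolVectorField n X)
    (hs : GenerateAtGeneralPoint s) :
    (frameMetric s).IsKahlerOn {x | GenerateAt s x} ↔
      IsAbelianSpace (Submodule.span ℂ (Set.range s)) := by
  rw [isAbelianSpace_span_iff]
  constructor
  · intro h j k
    obtain ⟨G, -, hG, hGs⟩ := hs
    -- The Kähler condition controls brackets only where the fields generate, which includes the
    -- dense set `G`.
    refine mlieBracket_eq_zero_of_dense hG (s j) (s k) fun x hx => ?_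
    obtain ⟨e, he, hxe⟩ := exists_mem_holCharts (n := n) x
    have hz : e x ∈ coordDomain e {x | GenerateAt s x} :=
      ⟨e.map_source hxe, by rw [Set.mem_preimage, e.left_inv hxe]; exact hGs x hx⟩
    have := (extDeriv_fundamentalForm_eq_zero_iff he s hz).1 (h e he _ hz) j k
    rwa [e.left_inv hxe] at this
  · intro h e he z hz
    exact (extDeriv_fundamentalForm_eq_zero_iff he s hz).2 fun j k => h j k _

end Metric

end FrameGeometry

end

theorem mainTheorem1 (n : ℕ) (X : Type*) [TopologicalSpace X] [T2Space X] [CompactSpace X]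
    [ChartedSpace (Fin n → ℂ) X] [IsManifold 𝓘(ℂ, Fin n → ℂ) ω X]
    (s : Fin n → FrameGeometry.HolVectorField n X)
    (hs : FrameGeometry.GenerateAtGeneralPoint s) :
    ∃ D : FrameGeometry.EffectiveDivisor n X,
      D ∈ FrameGeometry.anticanonicalSystem n X ∧
      -- `D` is the zero divisor of the wedge product, and depends only on the span of the fields
      (∀ t : Fin n → FrameGeometry.HolVectorField n X,
        Submodule.span ℂ (Set.range t) = Submodule.span ℂ (Set.range s) →
          D.IsZeroDivisorOf (FrameGeometry.wedge t)) ∧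
      D.support = {x | FrameGeometry.wedge s x = 0} ∧
      D.supportᶜ = {x | FrameGeometry.GenerateAt s x} ∧
      (FrameGeometry.frameMetric s).IsHermitianMetricOn D.supportᶜ ∧
      (FrameGeometry.frameMetric s).IsRicciFlatOn D.supportᶜ ∧
      ((FrameGeometry.frameMetric s).IsKahlerOn D.supportᶜ ↔
        FrameGeometry.IsAbelianSpace (Submodule.span ℂ (Set.range s))) := by
  have hsupp := FrameGeometry.wedgeDivisor_support s hs
  have hcompl : (FrameGeometry.wedgeDivisor s hs).supportᶜ =
      {x | FrameGeometry.GenerateAt s x} := by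
    rw [hsupp]
    ext x
    simp [FrameGeometry.wedge_eq_zero_iff]
  refine ⟨FrameGeometry.wedgeDivisor s hs, ⟨FrameGeometry.wedge s,
    FrameGeometry.wedge_isHolomorphic s, FrameGeometry.wedgeDivisor_isZeroDivisorOf hs rfl⟩,
    fun t ht => FrameGeometry.wedgeDivisor_isZeroDivisorOf hs ht, hsupp, hcompl, ?_⟩
  rw [hcompl]
  exact ⟨FrameGeometry.frameMetric_isHermitianMetricOn s,
    FrameGeometry.frameMetric_isRicciFlatOn s, FrameGeometry.frameMetric_isKahlerOn_iff s hs⟩
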